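/- Let $d,m\ge 0$ and $N\ge 1$ be integers, let $h>0$ and $T=Nh$, and let $b_t:\mathbb R^d\to\mathbb R^d$ and $\sigma_t:\mathbb R^d\to\mathbb R^{d\times m}$ ($t\in[0,T]$). Suppose that there are $\alpha\in\mathbb R$ and $\beta,\lambda,\Lambda>0$ such that for all $x,y\in\mathbb R^d$ and $t\in[0,T]$, $$\langle b_t(x)-b_t(y),x-y\rangle+\tfrac12\|\sigma_t(x)-\sigma_t(y)\|_{\rm HS}^2\le-\alpha\|x-y\|^2,\qquad \|b_t(x)-b_t(y)\|\le\beta\|x-y\|,\qquad \lambda I\preceq\sigma_t(x)\sigma_t(x)^{\mathsf T}\preceq\Lambda I .$$ Consider the discrete-time process $$\hat X_{(n+1)h}=\hat X_{nh}+h\,b_{nh}(\hat X_{nh})+\sqrt h\,\sigma_{nh}(\hat X_{nh})\,\xi_{nh},$$ where $(\xi_{nh})_{n\ge0}$ are i.i.d. standard Gaussian vectors in $\mathbb R^m$, and let $\hat P_h^N$ denote its $N$-step transition kernel from time $0$ to time $Nh$. Put $L^2:=1-2\alpha h+\beta^2h^2$. Then for all positive measurable functions $f:\mathbb R^d\to\mathbb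 R$ and all $x,y\in\mathbb R^d$, $$\hat P_h^Nf(x)\le\Bigl(1+\frac{4(\beta-\alpha)(\Lambda/\lambda)^3h}{L^2}\Bigr)\,\frac{\alpha-\beta^2h/2}{\lambda\,(L^{-2N}-1)}\,\|x-y\|^2+\log\hat P_h^N(\exp f)(y),$$ where both sides may be $+\infty$, and the coefficient of $\|x-y\|^2$ is read as its limit $\bigl(1+4(\beta-\alpha)(\Lambda/\lambda)^3h\bigr)\frac{1}{2\lambda hN}$ if $L^2=1$, and as $0$ if $L^2=0$. Moreover, if $0<L^2<1$, then also $$\hat P_h^Nf(x)\le\Bigl(1+\frac{4(\beta-\alpha)(\Lambda/\lambda)^3h}{L^2}\Bigr)\,\frac{\alpha\,(1-\beta h/2)}{\lambda\,(L^{-2N}-1)}\,\|x-y\|^2+\log\hat P_h^N(\exp f)(y).$$ -/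

import Mathlib

open MeasureTheory ProbabilityTheory

noncomputable section

/-- Squared Hilbert–Schmidt norm of a real matrix. -/
def hsNormSq {d m : ℕ} (A : Matrix (Fin d) (Fin m) ℝ) : ℝ :=
  ∑ i, ∑ j, A i j ^ 2

/-- One step of the Euler scheme with step size `h`, drift `b`, diffusion coefficient `σ`, from
the state `x` and with the noise `ξ`: `x + h b(x) + √h σ(x) ξ`. -/
def eulerMap {d m : ℕ} (h : ℝ) (b : EuclideanSpace ℝ (Fin d) → EuclideanSpace ℝ (Fin d))
    (σ : EuclideanSpace ℝ (Fin d) → Matrix (Fin d) (Fin m) ℝ)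
    (x : EuclideanSpace ℝ (Fin d)) (ξ : EuclideanSpace ℝ (Fin m)) : EuclideanSpace ℝ (Fin d) :=
  x + h • b x + √h • Matrix.toEuclideanLin (σ x) ξ

/-- Transition kernel of one Euler step: `x ↦ Law(x + h b(x) + √h σ(x) ξ)` with `ξ` a standard
Gaussian vector. (`Kernel.map` asks for the Euler map to be measurable, which holds for measurable
`b` and `σ`, in particular for Lipschitz ones.) -/
def eulerKernel {d m : ℕ} (h : ℝ) (b : EuclideanSpace ℝ (Fin d) → EuclideanSpace ℝ (Fin d))
    (σ : EuclideanSpace ℝ (Fin d) → Matrix (Fin d) (Fin m) ℝ) :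
    Kernel (EuclideanSpace ℝ (Fin d)) (EuclideanSpace ℝ (Fin d)) :=
  (Kernel.id ×ₖ Kernel.const (EuclideanSpace ℝ (Fin d))
    (stdGaussian (EuclideanSpace ℝ (Fin m)))).map (fun p => eulerMap h b σ p.1 p.2)

/-- The `n`-step transition kernel, from time `0` to time `n h`, of the process
`X_{(k+1)h} = X_{kh} + h b_{kh}(X_{kh}) + √h σ_{kh}(X_{kh}) ξ_{kh}` with i.i.d. standard Gaussian
vectors `ξ_{kh}`. -/
def eulerKernelIter {d m : ℕ} (h : ℝ)
    (b : ℝ → EuclideanSpace ℝ (Fin d) → EuclideanSpace ℝ (Fin d))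
    (σ : ℝ → EuclideanSpace ℝ (Fin d) → Matrix (Fin d) (Fin m) ℝ) :
    ℕ → Kernel (EuclideanSpace ℝ (Fin d)) (EuclideanSpace ℝ (Fin d))
  | 0 => Kernel.id
  | n + 1 => eulerKernel h (b (n * h)) (σ (n * h)) ∘ₖ eulerKernelIter h b σ n

/-- `L² = 1 - 2 α h + β² h²`. -/
def eulerLSq (α β h : ℝ) : ℝ := 1 - 2 * α * h + β ^ 2 * h ^ 2

/-- The constant
`(1 + 4 (β - α) (Λ/λ)³ h / L²) (α - β² h / 2) / (λ (L^{-2N} - 1))`.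
Here `α - β² h / 2 = (1 - L²) / (2 h)`, and at `L² = 1` and `L² = 0`, where the formula reads
`0 / 0` or contains `L^{-2N} = ∞`, the constant is its limit. -/
def logHarnackConst (α β lam Lam h : ℝ) (N : ℕ) : ℝ :=
  if eulerLSq α β h = 0 then 0
  else if eulerLSq α β h = 1 then
    (1 + 4 * (β - α) * (Lam / lam) ^ 3 * h) * (1 / (2 * lam * h * N))
  else
    (1 + 4 * (β - α) * (Lam / lam) ^ 3 * h / eulerLSq α β h) *
      ((α - β ^ 2 * h / 2) / (lam * ((eulerLSq α β h ^ N)⁻¹ - 1)))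

/-- The constant with the numerator `α (1 - β h / 2)`:
`(1 + 4 (β - α) (Λ/λ)³ h / L²) α (1 - β h / 2) / (λ (L^{-2N} - 1))`. -/
def logHarnackConst' (α β lam Lam h : ℝ) (N : ℕ) : ℝ :=
  (1 + 4 * (β - α) * (Lam / lam) ^ 3 * h / eulerLSq α β h) *
    ((α * (1 - β * h / 2)) / (lam * ((eulerLSq α β h ^ N)⁻¹ - 1)))

/-- `P f(x) ≤ C ‖x - y‖² + log P(exp f)(y)` for all positive measurable `f` and all `x, y`. Both
integrals are taken in `[0, ∞]` and the inequality in `[-∞, ∞]`, so no integrability is needed. -/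
def LogHarnack {d : ℕ} (P : Kernel (EuclideanSpace ℝ (Fin d)) (EuclideanSpace ℝ (Fin d)))
    (C : ℝ) : Prop :=
  ∀ f : EuclideanSpace ℝ (Fin d) → ℝ, Measurable f → (∀ z, 0 < f z) →
    ∀ x y : EuclideanSpace ℝ (Fin d),
      ((∫⁻ z, ENNReal.ofReal (f z) ∂(P x) : ENNReal) : EReal) ≤
        ((C * ‖x - y‖ ^ 2 : ℝ) : EReal) +
          ENNReal.log (∫⁻ z, ENNReal.ofReal (Real.exp (f z)) ∂(P y))

end

/-!
For a kernel `P`, consider the best constant `C` in `KL(P x ‖ P y) ≤ C ‖x - y‖²`. By the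
Donsker–Varadhan duality this is the constant of the log-Harnack inequality.

For one Euler step, `P x` and `P y` are Gaussian. The difference of the means is controlled by the
contraction of the drift; the covariances enter through the eigenvalues `u` of the covariance of
`P x` whitened by that of `P y`: `u - 1 - log u ≤ r / 2 * (u - 1)²` whenever `u ≥ r⁻¹` and `r ≥ 1`.

Iterating is done by shifted composition. If the tail of the chain has constant `D`, let the first
step start from the intermediate point `y + η (x - y)` instead of `x`. Moving from this point to
`y` costs `C η² ‖x - y‖²` in entropy at the first step. The synchronous coupling contracts squared
distances by `q = L²`, so the tail only has to make up `q (1 - η)² ‖x - y‖²`, at the price `D` per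
unit. Optimising `η` in every step gives `C qⁿ / (1 + q + ⋯ + qⁿ)` after `n + 1` steps.
-/

lemma sub_one_sub_log_le_of_one_le {u : ℝ} (hu : 1 ≤ u) :
    u - 1 - Real.log u ≤ 1 / 2 * (u - 1) ^ 2 := by
  have h_log := Real.le_log_one_add_of_nonneg (x := u - 1) (by linarith)
  rw [add_sub_cancel] at h_log
  have h_frac : (u - 1) - (u - 1) ^ 2 / 2 ≤ 2 * (u - 1) / (u - 1 + 2) := by
    rw [le_div_iff₀ (by linarith)]
    nlinarith [pow_nonneg (sub_nonneg.2 hu) 3]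
  linarith

lemma sub_one_sub_log_le_of_le_one {u : ℝ} (hu : 0 < u) (hu1 : u ≤ 1) :
    u - 1 - Real.log u ≤ u⁻¹ / 2 * (u - 1) ^ 2 := by
  have h_sinh : -Real.log u ≤ Real.sinh (-Real.log u) :=
    Real.self_le_sinh_iff.2 (neg_nonneg.2 (Real.log_nonpos hu.le hu1))
  rw [Real.sinh_eq, neg_neg, Real.exp_neg, Real.exp_log hu] at h_sinh
  have h_eq : u - 1 + (u⁻¹ - u) / 2 = u⁻¹ / 2 * (u - 1) ^ 2 := by
    field_simp
    ring
  linarith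

lemma sub_one_sub_log_le {r u : ℝ} (hr : 1 ≤ r) (hu : r⁻¹ ≤ u) :
    u - 1 - Real.log u ≤ r / 2 * (u - 1) ^ 2 := by
  have hu_pos : 0 < u := (inv_pos.2 (by linarith)).trans_le hu
  rcases le_total 1 u with h | h
  · exact (sub_one_sub_log_le_of_one_le h).trans (by gcongr)
  · exact (sub_one_sub_log_le_of_le_one hu_pos h).trans
      (by gcongr; exact inv_le_of_inv_le₀ (by linarith) hu)

section HilbertSchmidt

open Matrix
open scoped MatrixOrder

variable {d m k : ℕ} {ι κ : Type*} [Fintype ι] [DecidableEq ι] [Fintype κ] [DecidableEq κ]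

lemma hsNormSq_eq_trace (A : Matrix (Fin d) (Fin m) ℝ) : hsNormSq A = (Aᵀ * A).trace := by
  simp only [hsNormSq, trace, diag_apply, mul_apply, transpose_apply, sq]
  exact Finset.sum_comm

lemma hsNormSq_nonneg (A : Matrix (Fin d) (Fin m) ℝ) : 0 ≤ hsNormSq A :=
  Finset.sum_nonneg fun _ _ ↦ Finset.sum_nonneg fun _ _ ↦ sq_nonneg _

lemma sq_apply_le_hsNormSq (A : Matrix (Fin d) (Fin m) ℝ) (i : Fin d) (j : Fin m) :
    A i j ^ 2 ≤ hsNormSq A :=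
  calc A i j ^ 2
      ≤ ∑ j, A i j ^ 2 := Finset.single_le_sum (fun _ _ ↦ sq_nonneg _) (Finset.mem_univ j)
    _ ≤ hsNormSq A := Finset.single_le_sum (f := fun i ↦ ∑ j, A i j ^ 2)
        (fun _ _ ↦ Finset.sum_nonneg fun _ _ ↦ sq_nonneg _) (Finset.mem_univ i)

lemma hsNormSq_transpose (A : Matrix (Fin d) (Fin m) ℝ) : hsNormSq Aᵀ = hsNormSq A :=
  Finset.sum_comm

lemma hsNormSq_smul (c : ℝ) (A : Matrix (Fin d) (Fin m) ℝ) :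
    hsNormSq (c • A) = c ^ 2 * hsNormSq A := by
  simp [hsNormSq, Finset.mul_sum, mul_pow]

lemma hsNormSq_add_le (A B : Matrix (Fin d) (Fin m) ℝ) :
    hsNormSq (A + B) ≤ 2 * hsNormSq A + 2 * hsNormSq B := by
  simp only [hsNormSq, Finset.mul_sum, ← Finset.sum_add_distrib]
  gcongr with i _ j _
  rw [Matrix.add_apply]
  nlinarith [sq_nonneg (A i j - B i j)]

lemma transpose_mul_self_le_of_mul_transpose_self_le {A : Matrix ι κ ℝ} {c : ℝ}
    (hc : 0 < c) (hA : A * Aᵀ ≤ c • 1) : Aᵀ * A ≤ c • 1 := by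
  have h_identity : c • (c • 1 - Aᵀ * A) =
      (c • 1 - Aᵀ * A)ᵀ * (c • 1 - Aᵀ * A) + Aᵀ * (c • 1 - A * Aᵀ) * A := by
    simp only [transpose_sub, transpose_smul, transpose_one, transpose_mul, transpose_transpose,
      Matrix.mul_sub, Matrix.sub_mul, Matrix.smul_mul, Matrix.mul_smul, Matrix.mul_one,
      Matrix.one_mul, smul_sub, Matrix.mul_assoc]
    abel
  have h_nonneg : 0 ≤ c • (c • 1 - Aᵀ * A) := by
    rw [h_identity, nonneg_iff_posSemidef]
    simpa only [conjTranspose_eq_transpose_of_trivial] using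
      (posSemidef_conjTranspose_mul_self (c • 1 - Aᵀ * A)).add
        ((le_iff.1 hA).conjTranspose_mul_mul_same A)
  simpa [smul_smul, hc.ne'] using smul_nonneg (inv_nonneg.2 hc.le) h_nonneg

lemma hsNormSq_mul_le {A : Matrix (Fin d) (Fin m) ℝ} {c : ℝ} (hA : Aᵀ * A ≤ c • 1)
    (X : Matrix (Fin m) (Fin k) ℝ) : hsNormSq (A * X) ≤ c * hsNormSq X := by
  have h_trace := ((le_iff.1 hA).conjTranspose_mul_mul_same X).trace_nonneg
  rw [conjTranspose_eq_transpose_of_trivial, Matrix.mul_sub, Matrix.sub_mul, trace_sub,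
    Matrix.mul_smul, Matrix.mul_one, Matrix.smul_mul, trace_smul, smul_eq_mul, ← hsNormSq_eq_trace,
    sub_nonneg] at h_trace
  rwa [hsNormSq_eq_trace, transpose_mul, ← Matrix.mul_assoc, Matrix.mul_assoc Xᵀ]

lemma hsNormSq_mul_transpose_le {A : Matrix (Fin d) (Fin m) ℝ} {c : ℝ} (hA : Aᵀ * A ≤ c • 1)
    (X : Matrix (Fin k) (Fin m) ℝ) : hsNormSq (X * Aᵀ) ≤ c * hsNormSq X := by
  rw [← hsNormSq_transpose, transpose_mul, transpose_transpose, ← hsNormSq_transpose X]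
  exact hsNormSq_mul_le hA Xᵀ

lemma hsNormSq_mul_transpose_self_sub_le {A B : Matrix (Fin d) (Fin m) ℝ} {c : ℝ} (hc : 0 < c)
    (hA : A * Aᵀ ≤ c • 1) (hB : B * Bᵀ ≤ c • 1) :
    hsNormSq (A * Aᵀ - B * Bᵀ) ≤ 4 * c * hsNormSq (A - B) := by
  have h_split : A * Aᵀ - B * Bᵀ = A * (A - B)ᵀ + (A - B) * Bᵀ := by
    rw [transpose_sub, Matrix.mul_sub, Matrix.sub_mul]
    abel
  calc hsNormSq (A * Aᵀ - B * Bᵀ)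
      ≤ 2 * hsNormSq (A * (A - B)ᵀ) + 2 * hsNormSq ((A - B) * Bᵀ) :=
        h_split ▸ hsNormSq_add_le _ _
    _ ≤ 2 * (c * hsNormSq (A - B)ᵀ) + 2 * (c * hsNormSq (A - B)) := by
        gcongr
        · exact hsNormSq_mul_le (transpose_mul_self_le_of_mul_transpose_self_le hc hA) _
        · exact hsNormSq_mul_transpose_le
            (transpose_mul_self_le_of_mul_transpose_self_le hc hB) _
    _ = 4 * c * hsNormSq (A - B) := by rw [hsNormSq_transpose]; ring

lemma trace_mul_self_eq_sum_eigenvalues_sq {M : Matrix ι ι ℝ} (hM : M.IsHermitian) :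
    (M * M).trace = ∑ i, hM.eigenvalues i ^ 2 := by
  have h_spectral : M * M = hM.eigenvectorUnitary *
      (diagonal hM.eigenvalues * diagonal hM.eigenvalues) *
      star (hM.eigenvectorUnitary : Matrix ι ι ℝ) := by
    conv_lhs => rw [hM.spectral_theorem, ← map_mul]
    simp [Unitary.conjStarAlgAut_apply]
  rw [h_spectral, trace_mul_comm, ← mul_assoc, Unitary.coe_star_mul_self, one_mul,
    diagonal_mul_diagonal, trace_diagonal]
  simp only [sq]

lemma hsNormSq_sub_one_eq_sum_eigenvalues {M : Matrix (Fin d) (Fin d) ℝ} (hM : M.IsHermitian) :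
    hsNormSq (M - 1) = ∑ i, (hM.eigenvalues i - 1) ^ 2 := by
  have h_transpose : Mᵀ = M := by simpa [IsHermitian] using hM
  have h_trace : M.trace = ∑ i, hM.eigenvalues i := by simpa using hM.trace_eq_sum_eigenvalues
  rw [hsNormSq_eq_trace, transpose_sub, h_transpose, transpose_one, Matrix.mul_sub,
    Matrix.sub_mul, Matrix.mul_one, Matrix.one_mul, trace_sub, trace_sub, trace_sub,
    trace_mul_self_eq_sum_eigenvalues_sq hM, h_trace, trace_one]
  simp only [sub_sq, mul_one, one_pow, Finset.sum_add_distrib, Finset.sum_sub_distrib,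
    ← Finset.mul_sum, Finset.sum_const, Finset.card_univ, nsmul_eq_mul]
  ring

lemma le_eigenvalues_of_smul_one_le {M : Matrix ι ι ℝ} (hM : M.IsHermitian) {c : ℝ}
    (hcM : c • 1 ≤ M) (i : ι) : c ≤ hM.eigenvalues i := by
  rw [← Algebra.algebraMap_eq_smul_one, algebraMap_le_iff_le_spectrum hM] at hcM
  exact hcM _ (hM.eigenvalues_mem_spectrum_real i)

lemma trace_sub_log_det_le {M : Matrix (Fin d) (Fin d) ℝ} {r : ℝ} (hr : 1 ≤ r)
    (hrM : r⁻¹ • 1 ≤ M) : M.trace - d - Real.log M.det ≤ r / 2 * hsNormSq (M - 1) := by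
  have hM : M.IsHermitian := by
    simpa using (le_iff.1 hrM).isHermitian.add (isHermitian_one.smul (k := r⁻¹) (.all _))
  have h_le (i) : r⁻¹ ≤ hM.eigenvalues i := le_eigenvalues_of_smul_one_le hM hrM i
  have h_pos (i) : 0 < hM.eigenvalues i := (inv_pos.2 (by linarith)).trans_le (h_le i)
  have h_det : M.det = ∏ i, hM.eigenvalues i := by simpa using hM.det_eq_prod_eigenvalues
  have h_trace : M.trace = ∑ i, hM.eigenvalues i := by simpa using hM.trace_eq_sum_eigenvalues
  have h_sum := Finset.sum_le_sum fun i (_ : i ∈ Finset.univ) ↦ sub_one_sub_log_le hr (h_le i)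
  rw [h_det, Real.log_prod fun i _ ↦ (h_pos i).ne', h_trace,
    hsNormSq_sub_one_eq_sum_eigenvalues hM, Finset.mul_sum]
  simpa [Finset.sum_sub_distrib] using h_sum

end HilbertSchmidt

section RelativeEntropy

variable {X Y : Type*} [MeasurableSpace X] [MeasurableSpace Y]

/-- The relative entropy of `μ` with respect to `ν` is at most `K`, in the dual form of Donsker
and Varadhan. Stated for bounded test functions, it needs neither absolute continuity nor a choice
of density, and it composes well with kernels. -/
def RelEntropyLE (μ ν : Measure X) (K : ℝ) : Prop :=
  ∀ f : X → ℝ, Measurable f → (∃ B, ∀ x, |f x| ≤ B) →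
    ∫ x, f x ∂μ ≤ Real.log (∫ x, Real.exp (f x) ∂ν) + K

lemma integrable_of_forall_abs_le {μ : Measure X} [IsFiniteMeasure μ] {f : X → ℝ}
    (hf : Measurable f) {B : ℝ} (hB : ∀ x, |f x| ≤ B) : Integrable f μ :=
  .of_bound hf.aestronglyMeasurable B (.of_forall hB)

lemma abs_exp_le_exp {a B : ℝ} (h : |a| ≤ B) : |Real.exp a| ≤ Real.exp B := by
  rw [Real.abs_exp]
  exact Real.exp_le_exp.2 ((le_abs_self a).trans h)

lemma integrable_exp_of_forall_abs_le {μ : Measure X} [IsFiniteMeasure μ] {f : X → ℝ}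
    (hf : Measurable f) {B : ℝ} (hB : ∀ x, |f x| ≤ B) : Integrable (fun x ↦ Real.exp (f x)) μ :=
  integrable_of_forall_abs_le hf.exp fun x ↦ abs_exp_le_exp (hB x)

lemma integral_le_log_integral_exp {μ : Measure X} [IsProbabilityMeasure μ] {f : X → ℝ}
    (hf : Integrable f μ) (hexp : Integrable (fun x ↦ Real.exp (f x)) μ) :
    ∫ x, f x ∂μ ≤ Real.log (∫ x, Real.exp (f x) ∂μ) := by
  rw [Real.le_log_iff_exp_le (integral_exp_pos hexp)]
  exact convexOn_exp.map_integral_le Real.continuous_exp.continuousOn isClosed_univ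
    (.of_forall fun _ ↦ Set.mem_univ _) hf hexp

lemma abs_log_integral_exp_le {μ : Measure X} [IsProbabilityMeasure μ] {f : X → ℝ}
    (hf : Measurable f) {B : ℝ} (hB : ∀ x, |f x| ≤ B) :
    |Real.log (∫ x, Real.exp (f x) ∂μ)| ≤ B := by
  have hexp : Integrable (fun x ↦ Real.exp (f x)) μ := integrable_exp_of_forall_abs_le hf hB
  have hpos := integral_exp_pos hexp
  rw [abs_le, Real.le_log_iff_exp_le hpos, Real.log_le_iff_le_exp hpos]
  constructor
  · simpa using integral_mono (integrable_const (Real.exp (-B))) hexp fun x ↦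
      Real.exp_le_exp.2 (abs_le.1 (hB x)).1
  · simpa using integral_mono hexp (integrable_const (Real.exp B)) fun x ↦
      Real.exp_le_exp.2 (abs_le.1 (hB x)).2

lemma integrable_integral_of_integrable_comp_measure {Q : Kernel X Y} {μ : Measure X} {f : Y → ℝ}
    (hf : Integrable f (Q ∘ₘ μ)) : Integrable (fun x ↦ ∫ y, f y ∂(Q x)) μ := by
  rw [Measure.comp_eq_comp_const_apply] at hf
  exact hf.integral_comp

lemma integral_comp_measure {Q : Kernel X Y} {μ : Measure X} {f : Y → ℝ}
    (hf : Integrable f (Q ∘ₘ μ)) : ∫ y, f y ∂(Q ∘ₘ μ) = ∫ x, ∫ y, f y ∂(Q x) ∂μ := by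
  rw [Measure.comp_eq_comp_const_apply] at hf ⊢
  rw [Kernel.integral_comp hf, Kernel.const_apply]

lemma abs_min_natCast_le {a : ℝ} (ha : 0 ≤ a) (n : ℕ) : |min a n| ≤ n := by
  rw [abs_of_nonneg (le_min ha n.cast_nonneg)]
  exact min_le_right _ _

lemma lintegral_ofReal_eq_iSup_min {μ : Measure X} {f : X → ℝ} (hf : Measurable f) :
    ∫⁻ x, ENNReal.ofReal (f x) ∂μ = ⨆ n : ℕ, ∫⁻ x, ENNReal.ofReal (min (f x) n) ∂μ := by
  have h_iSup (x : X) : ENNReal.ofReal (f x) = ⨆ n : ℕ, ENNReal.ofReal (min (f x) n) := by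
    refine le_antisymm ?_ (iSup_le fun n ↦ ENNReal.ofReal_le_ofReal (min_le_left _ _))
    obtain ⟨n, hn⟩ := exists_nat_ge (f x)
    exact le_iSup_of_le n (by rw [min_eq_left hn])
  simp_rw [h_iSup]
  exact lintegral_iSup (fun n ↦ by fun_prop) fun m n hmn x ↦
    ENNReal.ofReal_le_ofReal (min_le_min_left _ (Nat.cast_le.2 hmn))

namespace RelEntropyLE

variable {μ ν : Measure X} {K : ℝ}

protected lemma refl (μ : Measure X) [IsProbabilityMeasure μ] : RelEntropyLE μ μ 0 := by
  rintro f hf ⟨B, hB⟩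
  rw [add_zero]
  exact integral_le_log_integral_exp (integrable_of_forall_abs_le hf hB)
    (integrable_exp_of_forall_abs_le hf hB)

lemma mono (h : RelEntropyLE μ ν K) {K' : ℝ} (hK : K ≤ K') : RelEntropyLE μ ν K' :=
  fun f hf hB ↦ (h f hf hB).trans (by gcongr)

lemma map (h : RelEntropyLE μ ν K) {g : X → Y} (hg : Measurable g) :
    RelEntropyLE (μ.map g) (ν.map g) K := by
  rintro f hf ⟨B, hB⟩
  rw [integral_map hg.aemeasurable hf.aestronglyMeasurable,
    integral_map hg.aemeasurable hf.exp.aestronglyMeasurable]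
  exact h _ (hf.comp hg) ⟨B, fun x ↦ hB (g x)⟩

lemma withDensity_exp [IsProbabilityMeasure μ] {ℓ : X → ℝ} (hℓ : Integrable ℓ μ)
    [IsFiniteMeasure (μ.withDensity fun x ↦ ENNReal.ofReal (Real.exp (ℓ x)))] :
    RelEntropyLE μ (μ.withDensity fun x ↦ ENNReal.ofReal (Real.exp (ℓ x))) (-∫ x, ℓ x ∂μ) := by
  rintro f hf ⟨B, hB⟩
  set ν := μ.withDensity fun x ↦ ENNReal.ofReal (Real.exp (ℓ x))
  have h_density : AEMeasurable (fun x ↦ ENNReal.ofReal (Real.exp (ℓ x))) μ :=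
    hℓ.aemeasurable.exp.ennreal_ofReal
  have h_smul (x : X) : (ENNReal.ofReal (Real.exp (ℓ x))).toReal • Real.exp (f x) =
      Real.exp (f x + ℓ x) := by
    rw [ENNReal.toReal_ofReal (Real.exp_pos _).le, smul_eq_mul, ← Real.exp_add, add_comm]
  have hf_int : Integrable f μ := integrable_of_forall_abs_le hf hB
  have hexp_int : Integrable (fun x ↦ Real.exp (f x + ℓ x)) μ := by
    simpa only [h_smul] using (integrable_withDensity_iff_integrable_smul₀' h_density
      (.of_forall fun _ ↦ ENNReal.ofReal_lt_top)).1
      (integrable_exp_of_forall_abs_le (μ := ν) hf hB)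
  have h_jensen := integral_le_log_integral_exp (hf_int.add hℓ) hexp_int
  simp only [Pi.add_apply, integral_add hf_int hℓ] at h_jensen
  rw [integral_withDensity_eq_integral_toReal_smul₀ h_density
    (.of_forall fun _ ↦ ENNReal.ofReal_lt_top)]
  simp only [h_smul]
  linarith

/-- Shifted composition: since `π.snd` is arbitrary, part of the discrepancy between `π.fst` and `ν`
can be deferred to the last step, where it costs the average of `c` over the coupling. -/
theorem comp_of_coupling {Q : Kernel X Y} [IsMarkovKernel Q] {π : Measure (X × X)}
    [IsProbabilityMeasure π] [IsFiniteMeasure ν] {c : X × X → ℝ} (hc : Integrable c π)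
    (hQ : ∀ p : X × X, RelEntropyLE (Q p.1) (Q p.2) (c p)) (hπ : RelEntropyLE π.snd ν K) :
    RelEntropyLE (Q ∘ₘ π.fst) (Q ∘ₘ ν) (∫ p, c p ∂π + K) := by
  rintro f hf ⟨B, hB⟩
  set g : X → ℝ := fun x ↦ Real.log (∫ y, Real.exp (f y) ∂(Q x))
  have hg_meas : Measurable g := hf.exp.stronglyMeasurable.integral_kernel.measurable.log
  have hg_bound (x : X) : |g x| ≤ B := abs_log_integral_exp_le hf hB
  have h_exp_g (x : X) : Real.exp (g x) = ∫ y, Real.exp (f y) ∂(Q x) :=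
    Real.exp_log (integral_exp_pos (integrable_exp_of_forall_abs_le hf hB))
  have hg_int : Integrable (fun p : X × X ↦ g p.2) π :=
    integrable_of_forall_abs_le (by fun_prop) fun p ↦ hg_bound p.2
  have hf_int : Integrable f (Q ∘ₘ π.fst) := integrable_of_forall_abs_le hf hB
  have hF_int : Integrable (fun x ↦ ∫ y, f y ∂(Q x)) π.fst :=
    integrable_integral_of_integrable_comp_measure hf_int
  have h_last_step : ∫ x, ∫ y, f y ∂(Q x) ∂π.fst ≤ ∫ x, g x ∂π.snd + ∫ p, c p ∂π := by
    rw [Measure.fst, Measure.snd, integral_map (by fun_prop) hF_int.aestronglyMeasurable,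
      integral_map (by fun_prop) hg_meas.aestronglyMeasurable, ← integral_add hg_int hc]
    exact integral_mono (hF_int.comp_measurable measurable_fst) (hg_int.add hc)
      fun p ↦ hQ p f hf ⟨B, hB⟩
  have h_earlier_steps := hπ g hg_meas ⟨B, hg_bound⟩
  rw [integral_comp_measure hf_int,
    integral_comp_measure (integrable_exp_of_forall_abs_le hf hB)]
  simp only [h_exp_g] at h_earlier_steps
  linarith

lemma integral_min_le [IsFiniteMeasure ν] [NeZero ν] (h : RelEntropyLE μ ν K) {f : X → ℝ}
    (hf : Measurable f) (hf_nonneg : ∀ x, 0 ≤ f x)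
    (hexp : Integrable (fun x ↦ Real.exp (f x)) ν) (n : ℕ) :
    ∫ x, min (f x) n ∂μ ≤ Real.log (∫ x, Real.exp (f x) ∂ν) + K := by
  have h_bound (x : X) : |min (f x) n| ≤ n := abs_min_natCast_le (hf_nonneg x) n
  have h_meas : Measurable fun x ↦ min (f x) n := by fun_prop
  have h_exp_min : Integrable (fun x ↦ Real.exp (min (f x) n)) ν :=
    integrable_exp_of_forall_abs_le h_meas h_bound
  calc ∫ x, min (f x) n ∂μ
      ≤ Real.log (∫ x, Real.exp (min (f x) n) ∂ν) + K := h _ h_meas ⟨n, h_bound⟩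
    _ ≤ Real.log (∫ x, Real.exp (f x) ∂ν) + K := by
        gcongr ?_ + K
        exact Real.log_le_log (integral_exp_pos h_exp_min)
          (integral_mono h_exp_min hexp fun x ↦ Real.exp_le_exp.2 (min_le_left _ _))

lemma lintegral_ofReal_le [IsFiniteMeasure μ] [IsFiniteMeasure ν] [NeZero ν]
    (h : RelEntropyLE μ ν K) {f : X → ℝ} (hf : Measurable f) (hf_nonneg : ∀ x, 0 ≤ f x)
    (hexp : Integrable (fun x ↦ Real.exp (f x)) ν) :
    ∫⁻ x, ENNReal.ofReal (f x) ∂μ ≤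
      ENNReal.ofReal (Real.log (∫ x, Real.exp (f x) ∂ν) + K) := by
  rw [lintegral_ofReal_eq_iSup_min hf]
  refine iSup_le fun n ↦ ?_
  have h_min_int : Integrable (fun x ↦ min (f x) n) μ :=
    integrable_of_forall_abs_le (by fun_prop) fun x ↦ abs_min_natCast_le (hf_nonneg x) n
  rw [← ofReal_integral_eq_lintegral_ofReal h_min_int
    (.of_forall fun x ↦ le_min (hf_nonneg x) n.cast_nonneg)]
  exact ENNReal.ofReal_le_ofReal (h.integral_min_le hf hf_nonneg hexp n)

theorem coe_lintegral_ofReal_le [IsFiniteMeasure μ] [IsFiniteMeasure ν] [NeZero ν]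
    (h : RelEntropyLE μ ν K) {f : X → ℝ} (hf : Measurable f) (hf_nonneg : ∀ x, 0 ≤ f x) :
    ((∫⁻ x, ENNReal.ofReal (f x) ∂μ : ENNReal) : EReal) ≤
      (K : EReal) + ENNReal.log (∫⁻ x, ENNReal.ofReal (Real.exp (f x)) ∂ν) := by
  by_cases h_top : ∫⁻ x, ENNReal.ofReal (Real.exp (f x)) ∂ν = ⊤
  · simp [h_top]
  have hexp : Integrable (fun x ↦ Real.exp (f x)) ν :=
    (lintegral_ofReal_ne_top_iff_integrable hf.exp.aestronglyMeasurable
      (.of_forall fun _ ↦ (Real.exp_pos _).le)).1 h_top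
  have h_nonneg : 0 ≤ Real.log (∫ x, Real.exp (f x) ∂ν) + K := by
    simpa [hf_nonneg] using h.integral_min_le hf hf_nonneg hexp 0
  rw [← ofReal_integral_eq_lintegral_ofReal hexp (.of_forall fun _ ↦ (Real.exp_pos _).le),
    ENNReal.log_ofReal_of_pos (integral_exp_pos hexp), ← EReal.coe_add, add_comm K,
    ← max_eq_left h_nonneg, ← EReal.coe_ennreal_ofReal]
  exact_mod_cast h.lintegral_ofReal_le hf hf_nonneg hexp

end RelEntropyLE

end RelativeEntropy

section StdGaussianDensity

variable {E : Type*} [NormedAddCommGroup E] [InnerProductSpace ℝ E]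

/-- The density of the standard Gaussian measure of a finite-dimensional inner product space. -/
noncomputable def stdGaussianDensity (v : E) : ℝ :=
  ((2 * Real.pi) ^ (Module.finrank ℝ E / 2 : ℝ))⁻¹ * Real.exp (-‖v‖ ^ 2 / 2)

lemma stdGaussianDensity_pos (v : E) : 0 < stdGaussianDensity v := by
  unfold stdGaussianDensity
  positivity

/-- The logarithm of the density of the standard Gaussian measure with respect to its image under
the affine map `v ↦ c + A v`, read at the point `c + A v`. -/
noncomputable def affineLogDensity (A : E →ₗ[ℝ] E) (c v : E) : ℝ :=
  Real.log |LinearMap.det A| + (‖v‖ ^ 2 / 2 - ‖c + A v‖ ^ 2 / 2)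

lemma abs_det_mul_stdGaussianDensity {A : E →ₗ[ℝ] E} (hA : LinearMap.det A ≠ 0) (c v : E) :
    |LinearMap.det A| * stdGaussianDensity (c + A v) =
      stdGaussianDensity v * Real.exp (affineLogDensity A c v) := by
  have h_exp : Real.exp (-‖c + A v‖ ^ 2 / 2) =
      Real.exp (-‖v‖ ^ 2 / 2) * Real.exp (‖v‖ ^ 2 / 2 - ‖c + A v‖ ^ 2 / 2) := by
    rw [← Real.exp_add]
    ring_nf
  rw [stdGaussianDensity, stdGaussianDensity, affineLogDensity, Real.exp_add,
    Real.exp_log (abs_pos.2 hA), h_exp]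
  ring

variable [MeasurableSpace E] [BorelSpace E]

lemma measurable_stdGaussianDensity : Measurable (stdGaussianDensity : E → ℝ) := by
  unfold stdGaussianDensity
  fun_prop

variable [FiniteDimensional ℝ E]

lemma integrable_stdGaussianDensity : Integrable (stdGaussianDensity : E → ℝ) := by
  have h_re (v : E) : (-(1 / 2 : ℂ) * ‖v‖ ^ 2 + 0 * inner ℝ 0 v).re = -‖v‖ ^ 2 / 2 := by
    rw [show (-(1 / 2 : ℂ) * ‖v‖ ^ 2 + 0 * inner ℝ 0 v) = ((-‖v‖ ^ 2 / 2 : ℝ) : ℂ) by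
      push_cast; ring, Complex.ofReal_re]
  have h := (GaussianFourier.integrable_cexp_neg_mul_sq_norm_add (V := E) (b := 1 / 2)
    (by norm_num) 0 0).norm
  simp only [Complex.norm_exp, h_re] at h
  exact h.const_mul _

theorem stdGaussian_eq_withDensity :
    stdGaussian E = volume.withDensity fun v : E ↦ ENNReal.ofReal (stdGaussianDensity v) := by
  have := isFiniteMeasure_withDensity_ofReal (μ := (volume : Measure E))
    integrable_stdGaussianDensity.hasFiniteIntegral
  refine Measure.ext_of_charFun (funext fun t ↦ ?_)
  have h_integrand (v : E) : (ENNReal.ofReal (stdGaussianDensity v)).toReal •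
      Complex.exp (inner ℝ v t * Complex.I) =
        (((2 * Real.pi) ^ (Module.finrank ℝ E / 2 : ℝ))⁻¹ : ℝ) *
          Complex.exp (-(1 / 2 : ℂ) * ‖v‖ ^ 2 + Complex.I * inner ℝ t v) := by
    rw [ENNReal.toReal_ofReal (stdGaussianDensity_pos v).le, stdGaussianDensity, Complex.real_smul,
      Complex.exp_add, real_inner_comm, Complex.ofReal_mul, mul_assoc, mul_comm Complex.I]
    push_cast
    congr 3
    ring
  have h_const : ((Real.pi : ℂ) / (1 / 2)) ^ (Module.finrank ℝ E / 2 : ℂ) =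
      (((2 * Real.pi) ^ (Module.finrank ℝ E / 2 : ℝ) : ℝ) : ℂ) := by
    rw [Complex.ofReal_cpow (by positivity)]
    push_cast
    congr 1
    ring
  rw [charFun_stdGaussian, charFun_apply, integral_withDensity_eq_integral_toReal_smul
    measurable_stdGaussianDensity.ennreal_ofReal (.of_forall fun _ ↦ ENNReal.ofReal_lt_top)]
  simp_rw [h_integrand]
  rw [integral_const_mul, GaussianFourier.integral_cexp_neg_mul_sq_norm_add (by norm_num),
    ← mul_assoc, h_const, ← Complex.ofReal_mul, inv_mul_cancel₀ (by positivity),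
    Complex.ofReal_one, one_mul]
  congr 1
  rw [Complex.I_sq]
  ring

lemma measurable_affineLogDensity (A : E →ₗ[ℝ] E) (c : E) : Measurable (affineLogDensity A c) := by
  have hA := A.continuous_of_finiteDimensional.measurable
  unfold affineLogDensity
  fun_prop

lemma volume_eq_smul_map_affine {A : E →ₗ[ℝ] E} (hA : LinearMap.det A ≠ 0) (c : E) :
    (volume : Measure E) = ENNReal.ofReal |LinearMap.det A| • volume.map (fun v ↦ c + A v) := by
  have hA_meas := A.continuous_of_finiteDimensional.measurable
  have h_comp : (volume : Measure E).map (fun v ↦ c + A v) = (volume.map A).map (c + ·) :=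
    (Measure.map_map (by fun_prop) hA_meas).symm
  rw [h_comp, Measure.map_linearMap_addHaar_eq_smul_addHaar _ hA, Measure.map_smul,
    map_add_left_eq_self, smul_smul, ← ENNReal.ofReal_mul (abs_nonneg _), abs_inv,
    mul_inv_cancel₀ (abs_ne_zero.2 hA), ENNReal.ofReal_one, one_smul]

theorem map_affine_withDensity_stdGaussian {A : E →ₗ[ℝ] E} (hA : LinearMap.det A ≠ 0) (c : E) :
    ((stdGaussian E).withDensity fun v ↦ ENNReal.ofReal (Real.exp (affineLogDensity A c v))).map
      (fun v ↦ c + A v) = stdGaussian E := by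
  have hA_meas := A.continuous_of_finiteDimensional.measurable
  have hρ : Measurable fun v : E ↦ ENNReal.ofReal (stdGaussianDensity v) :=
    measurable_stdGaussianDensity.ennreal_ofReal
  have hℓ : Measurable fun v ↦ ENNReal.ofReal (Real.exp (affineLogDensity A c v)) :=
    (measurable_affineLogDensity A c).exp.ennreal_ofReal
  refine Measure.ext_of_lintegral _ fun φ hφ ↦ ?_
  rw [lintegral_map hφ (by fun_prop), lintegral_withDensity_eq_lintegral_mul _ hℓ (by fun_prop),
    stdGaussian_eq_withDensity, lintegral_withDensity_eq_lintegral_mul _ hρ (by fun_prop),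
    lintegral_withDensity_eq_lintegral_mul _ hρ hφ]
  conv_rhs => rw [volume_eq_smul_map_affine hA c]
  rw [lintegral_smul_measure, lintegral_map (by fun_prop) (by fun_prop), smul_eq_mul,
    ← lintegral_const_mul _ (by fun_prop)]
  refine lintegral_congr fun v ↦ ?_
  simp only [Pi.mul_apply]
  rw [← mul_assoc, ← mul_assoc, ← ENNReal.ofReal_mul (abs_nonneg _),
    ← ENNReal.ofReal_mul (stdGaussianDensity_pos v).le, abs_det_mul_stdGaussianDensity hA]

theorem relEntropyLE_map_affine_stdGaussian {A : E →ₗ[ℝ] E} (hA : LinearMap.det A ≠ 0) (c : E) :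
    RelEntropyLE ((stdGaussian E).map fun v ↦ c + A v) (stdGaussian E)
      ((∫ v, ‖c + A v‖ ^ 2 ∂(stdGaussian E) - ∫ v, ‖v‖ ^ 2 ∂(stdGaussian E)) / 2
        - Real.log |LinearMap.det A|) := by
  have hA_cont := A.continuous_of_finiteDimensional
  have h_affine : Integrable (fun v ↦ ‖c + A v‖ ^ 2) (stdGaussian E) :=
    ((memLp_const c).add (A.toContinuousLinearMap.comp_memLp'
      (IsGaussian.memLp_two_id (μ := stdGaussian E)))).integrable_norm_pow (by norm_num)
  have h_norm : Integrable (fun v : E ↦ ‖v‖ ^ 2) (stdGaussian E) :=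
    IsGaussian.memLp_two_id.integrable_norm_pow (by norm_num)
  have h_diff : Integrable (fun v ↦ ‖v‖ ^ 2 / 2 - ‖c + A v‖ ^ 2 / 2) (stdGaussian E) :=
    (h_norm.div_const 2).sub (h_affine.div_const 2)
  have hℓ : Integrable (affineLogDensity A c) (stdGaussian E) := (integrable_const _).add h_diff
  have h_integral : ∫ v, affineLogDensity A c v ∂(stdGaussian E) = Real.log |LinearMap.det A| +
      ((∫ v, ‖v‖ ^ 2 ∂(stdGaussian E)) / 2 - (∫ v, ‖c + A v‖ ^ 2 ∂(stdGaussian E)) / 2) := by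
    unfold affineLogDensity
    rw [integral_add (integrable_const _) h_diff, integral_const, probReal_univ, one_smul,
      integral_sub (h_norm.div_const 2) (h_affine.div_const 2), integral_div, integral_div]
  have : IsFiniteMeasure ((stdGaussian E).withDensity fun v ↦
      ENNReal.ofReal (Real.exp (affineLogDensity A c v))) := by
    rw [← Measure.isFiniteMeasure_map_iff (f := fun v ↦ c + A v) (by fun_prop),
      map_affine_withDensity_stdGaussian hA]
    infer_instance
  have h_map := (RelEntropyLE.withDensity_exp hℓ).map (g := fun v ↦ c + A v) (by fun_prop)
  rw [map_affine_withDensity_stdGaussian hA] at h_map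
  exact h_map.mono (by rw [h_integral]; linarith)

end StdGaussianDensity

section MultivariateGaussian

open Matrix
open scoped MatrixOrder

variable {ι κ : Type*} [Fintype ι] [DecidableEq ι] [Fintype κ] [DecidableEq κ]

lemma inner_toEuclideanLin (B : Matrix ι κ ℝ) (v : EuclideanSpace ℝ κ) (t : EuclideanSpace ℝ ι) :
    inner ℝ (toEuclideanLin B v) t = inner ℝ v (toEuclideanLin Bᵀ t) := by
  simp only [EuclideanSpace.inner_eq_star_dotProduct, ofLp_toLpLin, toLin'_apply, star_trivial]
  rw [dotProduct_mulVec, ← mulVec_transpose]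

theorem multivariateGaussian_map_affine {S : Matrix κ κ ℝ} (hS : S.PosSemidef) (B : Matrix ι κ ℝ)
    (c : EuclideanSpace ℝ κ) (m : EuclideanSpace ℝ ι) :
    (multivariateGaussian c S).map (fun v ↦ m + toEuclideanLin B v) =
      multivariateGaussian (m + toEuclideanLin B c) (B * S * Bᵀ) := by
  have hB := (toEuclideanLin B).continuous_of_finiteDimensional.measurable
  have hBSB : (B * S * Bᵀ).PosSemidef := by
    simpa using hS.mul_mul_conjTranspose_same B
  have := Measure.isProbabilityMeasure_map (μ := multivariateGaussian c S)
    (f := fun v ↦ m + toEuclideanLin B v) (by fun_prop)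
  refine Measure.ext_of_charFun (funext fun t ↦ ?_)
  have h_inner (v : EuclideanSpace ℝ κ) : Complex.exp (inner ℝ (m + toEuclideanLin B v) t *
      Complex.I) = Complex.exp (inner ℝ m t * Complex.I) *
        Complex.exp (inner ℝ v (toEuclideanLin Bᵀ t) * Complex.I) := by
    rw [inner_add_left, inner_toEuclideanLin, ← Complex.exp_add]
    push_cast
    ring_nf
  have h_cov : (toEuclideanLin Bᵀ t).ofLp ⬝ᵥ S *ᵥ (toEuclideanLin Bᵀ t).ofLp =
      t.ofLp ⬝ᵥ (B * S * Bᵀ) *ᵥ t.ofLp := by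
    simp only [ofLp_toLpLin, toLin'_apply]
    rw [← mulVec_mulVec, ← mulVec_mulVec, dotProduct_mulVec t.ofLp, ← mulVec_transpose]
  rw [charFun_apply, integral_map (by fun_prop) (by fun_prop)]
  simp_rw [h_inner]
  rw [integral_const_mul, ← charFun_apply, charFun_multivariateGaussian hS,
    charFun_multivariateGaussian hBSB, h_cov, ← Complex.exp_add, inner_add_right,
    real_inner_comm t m, inner_toEuclideanLin, transpose_transpose]
  push_cast
  ring_nf

lemma integral_norm_sq_multivariateGaussian {S : Matrix ι ι ℝ} (hS : S.PosSemidef)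
    (c : EuclideanSpace ℝ ι) :
    ∫ v, ‖v‖ ^ 2 ∂(multivariateGaussian c S) = ‖c‖ ^ 2 + S.trace := by
  set γ := multivariateGaussian c S
  have h_memLp (i : ι) : MemLp (fun v : EuclideanSpace ℝ ι ↦ v i) 2 γ :=
    (EuclideanSpace.proj (𝕜 := ℝ) i).comp_memLp' (IsGaussian.memLp_two_id (μ := γ))
  have h_mean (i : ι) : ∫ v, v i ∂γ = c i := by
    have h := (EuclideanSpace.proj (𝕜 := ℝ) i).integral_comp_comm
      (IsGaussian.integrable_id (μ := γ))
    simpa [γ] using h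
  have h_sq (i : ι) : ∫ v, v i ^ 2 ∂γ = c i ^ 2 + S i i := by
    have h_var := variance_eval_multivariateGaussian (μ := c) hS i
    rw [variance_eq_sub (h_memLp i), h_mean] at h_var
    simp only [Pi.pow_apply] at h_var
    linarith
  simp_rw [EuclideanSpace.real_norm_sq_eq]
  rw [integral_finsetSum _ fun i _ ↦ (h_memLp i).integrable_sq]
  simp only [h_sq, Finset.sum_add_distrib, Matrix.trace, diag_apply]

theorem relEntropyLE_multivariateGaussian_zero_one {M : Matrix ι ι ℝ} (hM : M.PosDef)
    (c : EuclideanSpace ℝ ι) :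
    RelEntropyLE (multivariateGaussian c M) (multivariateGaussian 0 1)
      ((‖c‖ ^ 2 + M.trace - Fintype.card ι - Real.log M.det) / 2) := by
  set A := toEuclideanLin (CFC.sqrt M)
  have h_map : (stdGaussian (EuclideanSpace ℝ ι)).map (fun v ↦ c + A v) =
      multivariateGaussian c M := rfl
  have h_det : LinearMap.det A = √M.det := by
    rw [LinearMap.det_toLpLin, hM.posSemidef.det_sqrt, RCLike.sqrt_real]
  have : Measurable A := A.continuous_of_finiteDimensional.measurable
  have hA : LinearMap.det A ≠ 0 := h_det ▸ (Real.sqrt_pos.2 hM.det_pos).ne'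
  have h_moment : ∫ v, ‖c + A v‖ ^ 2 ∂(stdGaussian (EuclideanSpace ℝ ι)) =
      ‖c‖ ^ 2 + M.trace := by
    rw [← integral_norm_sq_multivariateGaussian hM.posSemidef, ← h_map,
      integral_map (by fun_prop) (by fun_prop)]
  have h_moment_std : ∫ v, ‖v‖ ^ 2 ∂(stdGaussian (EuclideanSpace ℝ ι)) = Fintype.card ι := by
    rw [← multivariateGaussian_zero_one, integral_norm_sq_multivariateGaussian .one]
    simp
  have h := relEntropyLE_map_affine_stdGaussian hA c
  rw [h_map, h_moment, h_moment_std, h_det, abs_of_nonneg (Real.sqrt_nonneg _),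
    Real.log_sqrt hM.det_pos.le] at h
  rw [multivariateGaussian_zero_one]
  exact h.mono (by linarith)

theorem relEntropyLE_multivariateGaussian_mul_transpose {S R : Matrix ι ι ℝ} (hS : S.PosDef)
    (hR : IsUnit R.det) (μ ν : EuclideanSpace ℝ ι) :
    RelEntropyLE (multivariateGaussian μ S) (multivariateGaussian ν (R * Rᵀ))
      ((‖toEuclideanLin R⁻¹ (μ - ν)‖ ^ 2 + (R⁻¹ * S * R⁻¹ᵀ).trace - Fintype.card ι -
        Real.log (R⁻¹ * S * R⁻¹ᵀ).det) / 2) := by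
  have hM : (R⁻¹ * S * R⁻¹ᵀ).PosDef := by
    simpa using hS.mul_mul_conjTranspose_same (B := R⁻¹)
      (vecMul_injective_of_isUnit ((isUnit_nonsing_inv_iff).2 ((isUnit_iff_isUnit_det R).2 hR)))
  have hR_meas := (toEuclideanLin R).continuous_of_finiteDimensional.measurable
  have h_mean : ν + toEuclideanLin R (toEuclideanLin R⁻¹ (μ - ν)) = μ := by
    rw [toLpLin_apply, toLpLin_apply, mulVec_mulVec, mul_nonsing_inv R hR, one_mulVec]
    exact add_sub_cancel ν μ
  have h_cov : R * (R⁻¹ * S * R⁻¹ᵀ) * Rᵀ = S := by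
    rw [Matrix.mul_assoc R⁻¹, mul_nonsing_inv_cancel_left R _ hR, Matrix.mul_assoc,
      ← transpose_mul, mul_nonsing_inv R hR, transpose_one, Matrix.mul_one]
  have h := (relEntropyLE_multivariateGaussian_zero_one hM (toEuclideanLin R⁻¹ (μ - ν))).map
    (g := fun v ↦ ν + toEuclideanLin R v) (by fun_prop)
  rwa [multivariateGaussian_map_affine hM.posSemidef, multivariateGaussian_map_affine .one, h_mean,
    h_cov, map_zero, add_zero, Matrix.mul_one] at h

omit [DecidableEq ι] in
lemma norm_sq_toEuclideanLin_le {A : Matrix ι κ ℝ} {c : ℝ} (hA : Aᵀ * A ≤ c • 1)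
    (v : EuclideanSpace ℝ κ) : ‖toEuclideanLin A v‖ ^ 2 ≤ c * ‖v‖ ^ 2 := by
  have h := (le_iff.1 hA).dotProduct_mulVec_nonneg v.ofLp
  rw [sub_mulVec, dotProduct_sub, smul_mulVec, one_mulVec, dotProduct_smul, star_trivial,
    ← mulVec_mulVec, dotProduct_mulVec, vecMul_transpose, sub_nonneg] at h
  rw [EuclideanSpace.real_norm_sq_eq, EuclideanSpace.real_norm_sq_eq]
  simpa [dotProduct, sq] using h

omit [Fintype ι] in
lemma posDef_of_smul_one_le {S : Matrix ι ι ℝ} {c : ℝ} (hc : 0 < c) (hS : c • 1 ≤ S) :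
    S.PosDef := by
  simpa using (PosDef.one.smul hc).add_posSemidef (le_iff.1 hS)

omit [Fintype ι] [DecidableEq ι] [DecidableEq κ] in
lemma mul_mul_transpose_le [Finite ι] {A B : Matrix κ κ ℝ} (hAB : A ≤ B) (Q : Matrix ι κ ℝ) :
    Q * A * Qᵀ ≤ Q * B * Qᵀ := by
  simpa [le_iff, Matrix.mul_sub, Matrix.sub_mul] using
    (le_iff.1 hAB).mul_mul_conjTranspose_same Q

lemma transpose_mul_self_le_of_mul_mul_transpose_eq_one {Q : Matrix ι κ ℝ} {S : Matrix κ κ ℝ}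
    {c : ℝ} (hc : 0 < c) (hS : c • 1 ≤ S) (hQ : Q * S * Qᵀ = 1) : Qᵀ * Q ≤ c⁻¹ • 1 := by
  refine transpose_mul_self_le_of_mul_transpose_self_le (inv_pos.2 hc) ?_
  have h := mul_mul_transpose_le hS Q
  rw [hQ, Matrix.mul_smul, Matrix.mul_one, Matrix.smul_mul] at h
  simpa [smul_smul, hc.ne'] using smul_le_smul_of_nonneg_left h (inv_pos.2 hc).le

omit [Fintype ι] in
lemma smul_one_le_mul_mul_transpose [Finite ι] {Q : Matrix ι κ ℝ} {S T : Matrix κ κ ℝ} {c C : ℝ}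
    (hc : 0 < c) (hC : 0 < C) (hS : c • 1 ≤ S) (hT : T ≤ C • 1) (hQ : Q * T * Qᵀ = 1) :
    (c / C) • 1 ≤ Q * S * Qᵀ := by
  have := Fintype.ofFinite ι
  have hS' := mul_mul_transpose_le hS Q
  have hT' := mul_mul_transpose_le hT Q
  rw [Matrix.mul_smul, Matrix.mul_one, Matrix.smul_mul] at hS' hT'
  rw [hQ] at hT'
  calc (c / C) • (1 : Matrix ι ι ℝ) ≤ (c / C) • C • (Q * Qᵀ) :=
        smul_le_smul_of_nonneg_left hT' (by positivity)
    _ = c • (Q * Qᵀ) := by rw [smul_smul, div_mul_cancel₀ c hC.ne']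
    _ ≤ Q * S * Qᵀ := hS'

lemma hsNormSq_mul_mul_transpose_sub_one_le {d : ℕ} {Q S T : Matrix (Fin d) (Fin d) ℝ} {c : ℝ}
    (hc : 0 ≤ c) (hQ : Qᵀ * Q ≤ c • 1) (hQT : Q * T * Qᵀ = 1) :
    hsNormSq (Q * S * Qᵀ - 1) ≤ c ^ 2 * hsNormSq (S - T) := by
  have h_sub : Q * S * Qᵀ - 1 = Q * (S - T) * Qᵀ := by
    rw [Matrix.mul_sub, Matrix.sub_mul, hQT]
  calc hsNormSq (Q * S * Qᵀ - 1)
      ≤ c * hsNormSq (Q * (S - T)) := h_sub ▸ hsNormSq_mul_transpose_le hQ _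
    _ ≤ c * (c * hsNormSq (S - T)) := by
        gcongr
        exact hsNormSq_mul_le hQ _
    _ = c ^ 2 * hsNormSq (S - T) := by ring

lemma exists_isUnit_det_eq_mul_transpose {S : Matrix ι ι ℝ} (hS : S.PosDef) :
    ∃ R : Matrix ι ι ℝ, IsUnit R.det ∧ S = R * Rᵀ := by
  obtain ⟨R, rfl⟩ : ∃ R, S = R * Rᵀ := by
    simpa [star_eq_conjTranspose] using
      CStarAlgebra.nonneg_iff_eq_mul_star_self.1 hS.posSemidef.nonneg
  refine ⟨R, isUnit_iff_ne_zero.2 fun h_det ↦ ?_, rfl⟩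
  simpa [h_det] using hS.det_pos

theorem relEntropyLE_multivariateGaussian {d : ℕ} {lam Lam : ℝ} (hlam : 0 < lam) (hle : lam ≤ Lam)
    {S₁ S₂ : Matrix (Fin d) (Fin d) ℝ} (hS₁ : lam • 1 ≤ S₁) (hS₂ : lam • 1 ≤ S₂)
    (hS₂' : S₂ ≤ Lam • 1) (μ ν : EuclideanSpace ℝ (Fin d)) :
    RelEntropyLE (multivariateGaussian μ S₁) (multivariateGaussian ν S₂)
      (‖μ - ν‖ ^ 2 / (2 * lam) + Lam / (4 * lam ^ 3) * hsNormSq (S₁ - S₂)) := by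
  have hLam : 0 < Lam := hlam.trans_le hle
  have hS₁_posDef := posDef_of_smul_one_le hlam hS₁
  obtain ⟨R, hR, rfl⟩ := exists_isUnit_det_eq_mul_transpose (posDef_of_smul_one_le hlam hS₂)
  set Q := R⁻¹
  have h_whiten : Q * (R * Rᵀ) * Qᵀ = 1 := by
    rw [nonsing_inv_mul_cancel_left R _ hR, ← transpose_mul, nonsing_inv_mul R hR, transpose_one]
  have hQ := transpose_mul_self_le_of_mul_mul_transpose_eq_one hlam hS₂ h_whiten
  have hM : (Lam / lam)⁻¹ • 1 ≤ Q * S₁ * Qᵀ :=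
    inv_div Lam lam ▸ smul_one_le_mul_mul_transpose hlam hLam hS₁ hS₂' h_whiten
  have h_hs := hsNormSq_mul_mul_transpose_sub_one_le (S := S₁) (by positivity) hQ h_whiten
  have h_cov := (trace_sub_log_det_le ((one_le_div hlam).2 hle) hM).trans
    (mul_le_mul_of_nonneg_left h_hs (by positivity))
  have h_mean := norm_sq_toEuclideanLin_le hQ (μ - ν)
  refine (relEntropyLE_multivariateGaussian_mul_transpose hS₁_posDef hR μ ν).mono ?_
  rw [Fintype.card_fin]
  calc _ ≤ (lam⁻¹ * ‖μ - ν‖ ^ 2 +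
          Lam / lam / 2 * (lam⁻¹ ^ 2 * hsNormSq (S₁ - R * Rᵀ))) / 2 := by
        gcongr
        linarith
    _ = ‖μ - ν‖ ^ 2 / (2 * lam) + Lam / (4 * lam ^ 3) * hsNormSq (S₁ - R * Rᵀ) := by
        field_simp
        ring

end MultivariateGaussian

section KernelIteration

variable {X : Type*} [MeasurableSpace X]

/-- The transition kernel from time `0` to time `n` of the time-inhomogeneous Markov chain whose
step from time `k` to time `k + 1` has kernel `K k`. -/
noncomputable def kernelIter (K : ℕ → Kernel X X) : ℕ → Kernel X X
  | 0 => Kernel.id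
  | n + 1 => K n ∘ₖ kernelIter K n

lemma kernelIter_succ' (K : ℕ → Kernel X X) (n : ℕ) :
    kernelIter K (n + 1) = kernelIter (fun i ↦ K (i + 1)) n ∘ₖ K 0 := by
  induction n with
  | zero => simp [kernelIter]
  | succ n ih => rw [kernelIter, ih, kernelIter, Kernel.comp_assoc]

lemma isMarkovKernel_kernelIter {K : ℕ → Kernel X X} {n : ℕ}
    (hK : ∀ i < n, IsMarkovKernel (K i)) : IsMarkovKernel (kernelIter K n) := by
  induction n with
  | zero => rw [kernelIter]; infer_instance
  | succ n ih =>
    have := ih fun i hi ↦ hK i (by lia)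
    have := hK n (by lia)
    rw [kernelIter]; infer_instance

end KernelIteration

section ShiftedComposition

variable {E : Type*} [NormedAddCommGroup E] [MeasurableSpace E] {P Q : Kernel E E} {C D q : ℝ}

/-- The relative entropy of `P x` with respect to `P y` is at most `C ‖x - y‖²` for all `x`
and `y`. -/
def EntropyCostLE (P : Kernel E E) (C : ℝ) : Prop :=
  ∀ x y, RelEntropyLE (P x) (P y) (C * ‖x - y‖ ^ 2)

/-- The squared `2`-Wasserstein distance between `P x` and `P y` is at most `q ‖x - y‖²`, witnessed
by a coupling. As `P x` is a marginal of a probability measure, `P` is a Markov kernel. -/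
def SqCouplingContraction (P : Kernel E E) (q : ℝ) : Prop :=
  ∀ x y, ∃ π : Measure (E × E), IsProbabilityMeasure π ∧ π.fst = P x ∧ π.snd = P y ∧
    Integrable (fun p ↦ ‖p.1 - p.2‖ ^ 2) π ∧ ∫ p, ‖p.1 - p.2‖ ^ 2 ∂π ≤ q * ‖x - y‖ ^ 2

lemma SqCouplingContraction.isMarkovKernel (hP : SqCouplingContraction P q) :
    IsMarkovKernel P where
  isProbabilityMeasure x := by
    obtain ⟨π, _, hfst, -⟩ := hP x x
    rw [← hfst]
    infer_instance

theorem EntropyCostLE.comp [NormedSpace ℝ E] [IsMarkovKernel Q] (hQ : EntropyCostLE Q D)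
    (hP : EntropyCostLE P C) (hPq : SqCouplingContraction P q) (hD : 0 ≤ D) (η : ℝ) :
    EntropyCostLE (Q ∘ₖ P) (D * q * (1 - η) ^ 2 + C * η ^ 2) := by
  intro x y
  have := hPq.isMarkovKernel
  set z := y + η • (x - y) with hz
  have hxz : ‖x - z‖ ^ 2 = (1 - η) ^ 2 * ‖x - y‖ ^ 2 := by
    rw [show x - z = (1 - η) • (x - y) by rw [hz]; module, norm_smul, mul_pow, Real.norm_eq_abs,
      sq_abs]
  have hzy : ‖z - y‖ ^ 2 = η ^ 2 * ‖x - y‖ ^ 2 := by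
    rw [hz, add_sub_cancel_left, norm_smul, mul_pow, Real.norm_eq_abs, sq_abs]
  obtain ⟨π, _, hfst, hsnd, hint, hle⟩ := hPq x z
  have h := RelEntropyLE.comp_of_coupling (ν := P y) (hint.const_mul D) (fun p ↦ hQ p.1 p.2)
    (hsnd ▸ hP z y)
  rw [integral_const_mul, hfst, ← Kernel.comp_apply, ← Kernel.comp_apply, hzy] at h
  rw [hxz] at hle
  exact h.mono (by linarith [mul_le_mul_of_nonneg_left hle hD])

theorem EntropyCostLE.kernelIter [NormedSpace ℝ E] (hC : 0 ≤ C) (hq : 0 ≤ q) (n : ℕ)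
    {K : ℕ → Kernel E E} (hK : ∀ i < n + 1, EntropyCostLE (K i) C)
    (hKq : ∀ i < n + 1, SqCouplingContraction (K i) q) :
    EntropyCostLE (kernelIter K (n + 1)) (C * q ^ n / ∑ i ∈ Finset.range (n + 1), q ^ i) := by
  induction n generalizing K with
  | zero => simpa [_root_.kernelIter] using hK 0 one_pos
  | succ n ih =>
    have h_tail := ih (fun i hi ↦ hK (i + 1) (by lia)) fun i hi ↦ hKq (i + 1) (by lia)
    have := isMarkovKernel_kernelIter (K := fun i ↦ K (i + 1)) (n := n + 1)
      fun i hi ↦ (hKq (i + 1) (by lia)).isMarkovKernel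
    rw [kernelIter_succ', Finset.sum_range_succ]
    set s := ∑ i ∈ Finset.range (n + 1), q ^ i with hs
    have hs_pos : 0 < s := by
      rw [hs, Finset.sum_range_succ']
      positivity
    -- the minimiser `η = D q / (D q + C)` of `D q (1 - η)² + C η²` for `D = C qⁿ / s`
    convert h_tail.comp (hK 0 (by lia)) (hKq 0 (by lia)) (by positivity)
      (q ^ (n + 1) / (s + q ^ (n + 1))) using 1
    field_simp
    ring

end ShiftedComposition

section LogHarnack

variable {d : ℕ} {P : Kernel (EuclideanSpace ℝ (Fin d)) (EuclideanSpace ℝ (Fin d))} {C D : ℝ}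

theorem EntropyCostLE.logHarnack [IsMarkovKernel P] (hP : EntropyCostLE P C) : LogHarnack P C :=
  fun _ hf hf_pos x y ↦ (hP x y).coe_lintegral_ofReal_le hf fun z ↦ (hf_pos z).le

lemma LogHarnack.mono (hP : LogHarnack P C) (hCD : C ≤ D) : LogHarnack P D :=
  fun f hf hf_pos x y ↦ (hP f hf hf_pos x y).trans (by gcongr)

lemma LogHarnack.of_subsingleton [Subsingleton (EuclideanSpace ℝ (Fin d))] [IsMarkovKernel P] :
    LogHarnack P C :=
  EntropyCostLE.logHarnack fun x y ↦ by
    rw [Subsingleton.elim y x]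
    simpa using RelEntropyLE.refl (P x)

end LogHarnack

section EulerScheme

open Matrix
open scoped MatrixOrder

variable {d m : ℕ} {b : EuclideanSpace ℝ (Fin d) → EuclideanSpace ℝ (Fin d)}
  {σ : EuclideanSpace ℝ (Fin d) → Matrix (Fin d) (Fin m) ℝ} {α β lam Lam h : ℝ}

/-- The drift `b` and the diffusion coefficient `σ` are jointly dissipative with rate `α`, and `b`
is `β`-Lipschitz. -/
structure DissipativeLipschitz (b : EuclideanSpace ℝ (Fin d) → EuclideanSpace ℝ (Fin d))
    (σ : EuclideanSpace ℝ (Fin d) → Matrix (Fin d) (Fin m) ℝ) (α β : ℝ) : Prop where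
  inner_sub_add_le : ∀ x y,
    inner ℝ (b x - b y) (x - y) + 1 / 2 * hsNormSq (σ x - σ y) ≤ -α * ‖x - y‖ ^ 2
  norm_sub_le : ∀ x y, ‖b x - b y‖ ≤ β * ‖x - y‖

/-- The diffusion matrices `σ x (σ x)ᵀ` are bounded below by `lam` and above by `Lam` in the
Loewner order. -/
structure UniformlyElliptic (σ : EuclideanSpace ℝ (Fin d) → Matrix (Fin d) (Fin m) ℝ)
    (lam Lam : ℝ) : Prop where
  le_mul_transpose : ∀ x, lam • 1 ≤ σ x * (σ x)ᵀ
  mul_transpose_le : ∀ x, σ x * (σ x)ᵀ ≤ Lam • 1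

namespace DissipativeLipschitz

variable (hbσ : DissipativeLipschitz b σ α β)
include hbσ

lemma hsNormSq_sub_le (x y : EuclideanSpace ℝ (Fin d)) :
    hsNormSq (σ x - σ y) ≤ 2 * (β - α) * ‖x - y‖ ^ 2 := by
  have h_cauchySchwarz := neg_le_of_abs_le (abs_real_inner_le_norm (b x - b y) (x - y))
  nlinarith [hbσ.inner_sub_add_le x y,
    mul_le_mul_of_nonneg_right (hbσ.norm_sub_le x y) (norm_nonneg (x - y))]

lemma rate_le_lipschitz [Nontrivial (EuclideanSpace ℝ (Fin d))] : α ≤ β := by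
  obtain ⟨x, hx⟩ := exists_ne (0 : EuclideanSpace ℝ (Fin d))
  have h := (hsNormSq_nonneg _).trans (hbσ.hsNormSq_sub_le x 0)
  rw [sub_zero] at h
  linarith [nonneg_of_mul_nonneg_left h (pow_pos (norm_pos_iff.2 hx) 2)]

lemma norm_sq_euler_sub_add_le (hh : 0 ≤ h) (x y : EuclideanSpace ℝ (Fin d)) :
    ‖x - y + h • (b x - b y)‖ ^ 2 + h * hsNormSq (σ x - σ y) ≤ eulerLSq α β h * ‖x - y‖ ^ 2 := by
  have h_lip : ‖b x - b y‖ ^ 2 ≤ (β * ‖x - y‖) ^ 2 := by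
    gcongr
    exact hbσ.norm_sub_le x y
  rw [norm_add_sq_real, norm_smul, real_inner_smul_right, real_inner_comm, eulerLSq,
    Real.norm_of_nonneg hh]
  nlinarith [mul_le_mul_of_nonneg_left h_lip (sq_nonneg h),
    mul_le_mul_of_nonneg_left (hbσ.inner_sub_add_le x y) hh]

lemma continuous_drift : Continuous b := by
  refine (LipschitzWith.of_dist_le_mul (K := β.toNNReal) fun x y ↦ ?_).continuous
  rw [dist_eq_norm, dist_eq_norm]
  exact (hbσ.norm_sub_le x y).trans (by gcongr; exact Real.le_coe_toNNReal β)

lemma continuous_diffusion : Continuous σ := by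
  refine continuous_matrix fun i j ↦ ?_
  refine (LipschitzWith.of_dist_le_mul (K := (√|2 * (β - α)|).toNNReal) fun x y ↦ ?_).continuous
  rw [Real.coe_toNNReal _ (Real.sqrt_nonneg _), Real.dist_eq, dist_eq_norm]
  refine abs_le_of_sq_le_sq ?_ (by positivity)
  rw [mul_pow, Real.sq_sqrt (abs_nonneg _)]
  calc (σ x i j - σ y i j) ^ 2
      ≤ hsNormSq (σ x - σ y) := sq_apply_le_hsNormSq (σ x - σ y) i j
    _ ≤ 2 * (β - α) * ‖x - y‖ ^ 2 := hbσ.hsNormSq_sub_le x y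
    _ ≤ |2 * (β - α)| * ‖x - y‖ ^ 2 := by gcongr; exact le_abs_self _

lemma measurable_eulerMap (h : ℝ) :
    Measurable fun p : EuclideanSpace ℝ (Fin d) × EuclideanSpace ℝ (Fin m) ↦
      eulerMap h b σ p.1 p.2 := by
  have hb := hbσ.continuous_drift
  have hσ := hbσ.continuous_diffusion
  have h_noise : Continuous fun p : EuclideanSpace ℝ (Fin d) × EuclideanSpace ℝ (Fin m) ↦
      toEuclideanLin (σ p.1) p.2 := by
    simp only [toLpLin_apply]
    fun_prop
  unfold eulerMap
  fun_prop

lemma eulerKernel_apply (h : ℝ) (x : EuclideanSpace ℝ (Fin d)) :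
    eulerKernel h b σ x = (stdGaussian (EuclideanSpace ℝ (Fin m))).map (eulerMap h b σ x) := by
  have h_meas := hbσ.measurable_eulerMap h
  rw [eulerKernel, Kernel.map_apply _ h_meas, Kernel.prod_apply, Kernel.id_apply,
    Kernel.const_apply, Measure.dirac_prod, Measure.map_map h_meas (by fun_prop)]
  rfl

end DissipativeLipschitz

lemma UniformlyElliptic.lower_le_upper [Nontrivial (EuclideanSpace ℝ (Fin d))]
    (hσ : UniformlyElliptic σ lam Lam) : lam ≤ Lam := by
  have : Nonempty (Fin d) := by
    by_contra h_empty
    rw [not_nonempty_iff] at h_empty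
    exact not_subsingleton (EuclideanSpace ℝ (Fin d)) inferInstance
  have h_psd := le_iff.1 ((hσ.le_mul_transpose 0).trans (hσ.mul_transpose_le 0))
  simpa using h_psd.diag_nonneg (i := Classical.arbitrary (Fin d))

lemma stdGaussian_map_add_sqrt_smul (hh : 0 ≤ h) (B : Matrix (Fin d) (Fin m) ℝ)
    (c : EuclideanSpace ℝ (Fin d)) :
    (stdGaussian (EuclideanSpace ℝ (Fin m))).map (fun v ↦ c + √h • toEuclideanLin B v) =
      multivariateGaussian c (h • (B * Bᵀ)) := by
  have h_map := multivariateGaussian_map_affine (κ := Fin m) .one (√h • B) 0 c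
  simpa [multivariateGaussian_zero_one, smul_smul, Real.mul_self_sqrt hh] using h_map

lemma map_eulerMap_sub_eulerMap (hh : 0 ≤ h) (x y : EuclideanSpace ℝ (Fin d)) :
    (stdGaussian (EuclideanSpace ℝ (Fin m))).map
        (fun v ↦ eulerMap h b σ x v - eulerMap h b σ y v) =
      multivariateGaussian (x - y + h • (b x - b y)) (h • ((σ x - σ y) * (σ x - σ y)ᵀ)) := by
  rw [← stdGaussian_map_add_sqrt_smul hh]
  refine congrArg (Measure.map · _) (funext fun v ↦ ?_)
  simp only [eulerMap, map_sub, LinearMap.sub_apply]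
  module

theorem sqCouplingContraction_eulerKernel (hh : 0 ≤ h) (hbσ : DissipativeLipschitz b σ α β) :
    SqCouplingContraction (eulerKernel h b σ) (eulerLSq α β h) := by
  intro x y
  have h_meas (z : EuclideanSpace ℝ (Fin d)) : Measurable (eulerMap h b σ z) :=
    (hbσ.measurable_eulerMap h).comp measurable_prodMk_left
  have h_pair := (h_meas x).prodMk (h_meas y)
  set γ := stdGaussian (EuclideanSpace ℝ (Fin m))
  set π := γ.map fun v ↦ (eulerMap h b σ x v, eulerMap h b σ y v)
  set Δσ := σ x - σ y
  have hΔσ : (h • (Δσ * Δσᵀ)).PosSemidef := by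
    simpa using (posSemidef_self_mul_conjTranspose Δσ).smul hh
  set δ := multivariateGaussian (x - y + h • (b x - b y)) (h • (Δσ * Δσᵀ)) with hδ
  have h_sub : MeasurePreserving (fun p ↦ p.1 - p.2) π δ := by
    refine ⟨by fun_prop, ?_⟩
    rw [Measure.map_map (by fun_prop) h_pair, hδ, ← map_eulerMap_sub_eulerMap hh]
    rfl
  have h_integral : ∫ p, ‖p.1 - p.2‖ ^ 2 ∂π = ∫ v, ‖v‖ ^ 2 ∂δ := by
    rw [← h_sub.map_eq, integral_map h_sub.aemeasurable (by fun_prop)]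
  refine ⟨π, Measure.isProbabilityMeasure_map h_pair.aemeasurable, ?_, ?_, ?_, ?_⟩
  · rw [hbσ.eulerKernel_apply, Measure.fst_map_prodMk (h_meas y)]
  · rw [hbσ.eulerKernel_apply, Measure.snd_map_prodMk (h_meas x)]
  · exact h_sub.integrable_comp_of_integrable
      (IsGaussian.memLp_two_id (μ := δ)).integrable_norm_pow'
  · rw [h_integral, integral_norm_sq_multivariateGaussian hΔσ, trace_smul, smul_eq_mul,
      trace_mul_comm, ← hsNormSq_eq_trace]
    exact hbσ.norm_sq_euler_sub_add_le hh x y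

/-- The entropy cost constant of one Euler step: the shift of the mean contributes
`eulerLSq α β h / (2 h lam)`, the change of the covariance the rest. -/
noncomputable def eulerStepConst (α β lam Lam h : ℝ) : ℝ :=
  (eulerLSq α β h + 4 * (β - α) * (Lam / lam) ^ 3 * h) / (2 * h * lam)

lemma eulerKernel_eq_multivariateGaussian (hh : 0 ≤ h) (hbσ : DissipativeLipschitz b σ α β)
    (x : EuclideanSpace ℝ (Fin d)) :
    eulerKernel h b σ x = multivariateGaussian (x + h • b x) (h • (σ x * (σ x)ᵀ)) := by
  rw [hbσ.eulerKernel_apply, ← stdGaussian_map_add_sqrt_smul hh]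
  rfl

theorem relEntropyLE_eulerKernel (hh : 0 < h) (hlam : 0 < lam) (hle : lam ≤ Lam)
    (hbσ : DissipativeLipschitz b σ α β) (hσ : UniformlyElliptic σ lam Lam)
    (x y : EuclideanSpace ℝ (Fin d)) :
    RelEntropyLE (eulerKernel h b σ x) (eulerKernel h b σ y)
      (‖x - y + h • (b x - b y)‖ ^ 2 / (2 * h * lam) +
        (Lam / lam) ^ 2 / lam * hsNormSq (σ x - σ y)) := by
  have h_lower (z : EuclideanSpace ℝ (Fin d)) : (h * lam) • 1 ≤ h • (σ z * (σ z)ᵀ) := by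
    rw [mul_smul]
    exact smul_le_smul_of_nonneg_left (hσ.le_mul_transpose z) hh.le
  have h_upper (z : EuclideanSpace ℝ (Fin d)) : h • (σ z * (σ z)ᵀ) ≤ (h * Lam) • 1 := by
    rw [mul_smul]
    exact smul_le_smul_of_nonneg_left (hσ.mul_transpose_le z) hh.le
  have hLam : 0 < Lam := hlam.trans_le hle
  have h_cov := hsNormSq_mul_transpose_self_sub_le hLam (hσ.mul_transpose_le x)
    (hσ.mul_transpose_le y)
  have h_gaussian := relEntropyLE_multivariateGaussian (mul_pos hh hlam)
    (mul_le_mul_of_nonneg_left hle hh.le) (h_lower x) (h_lower y) (h_upper y)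
    (x + h • b x) (y + h • b y)
  rw [eulerKernel_eq_multivariateGaussian hh.le hbσ, eulerKernel_eq_multivariateGaussian hh.le hbσ]
  refine h_gaussian.mono ?_
  rw [show x + h • b x - (y + h • b y) = x - y + h • (b x - b y) by module, ← smul_sub,
    hsNormSq_smul, ← mul_assoc 2 h lam]
  refine add_le_add le_rfl ?_
  calc h * Lam / (4 * (h * lam) ^ 3) * (h ^ 2 * hsNormSq (σ x * (σ x)ᵀ - σ y * (σ y)ᵀ))
      ≤ h * Lam / (4 * (h * lam) ^ 3) * (h ^ 2 * (4 * Lam * hsNormSq (σ x - σ y))) := by gcongr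
    _ = (Lam / lam) ^ 2 / lam * hsNormSq (σ x - σ y) := by field_simp

theorem entropyCostLE_eulerKernel (hh : 0 < h) (hlam : 0 < lam) (hle : lam ≤ Lam)
    (hbσ : DissipativeLipschitz b σ α β) (hσ : UniformlyElliptic σ lam Lam) :
    EntropyCostLE (eulerKernel h b σ) (eulerStepConst α β lam Lam h) := by
  intro x y
  refine (relEntropyLE_eulerKernel hh hlam hle hbσ hσ x y).mono ?_
  set s := hsNormSq (σ x - σ y)
  have hs_nonneg : 0 ≤ s := hsNormSq_nonneg _
  have h_mean : ‖x - y + h • (b x - b y)‖ ^ 2 ≤ eulerLSq α β h * ‖x - y‖ ^ 2 :=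
    (le_add_of_nonneg_right (by positivity)).trans (hbσ.norm_sq_euler_sub_add_le hh.le x y)
  have h_ratio : (Lam / lam) ^ 2 ≤ (Lam / lam) ^ 3 :=
    pow_le_pow_right₀ ((one_le_div hlam).2 hle) (by norm_num)
  calc ‖x - y + h • (b x - b y)‖ ^ 2 / (2 * h * lam) + (Lam / lam) ^ 2 / lam * s
      ≤ eulerLSq α β h * ‖x - y‖ ^ 2 / (2 * h * lam) +
        (Lam / lam) ^ 3 / lam * (2 * (β - α) * ‖x - y‖ ^ 2) := by
        have hLam : 0 < Lam := hlam.trans_le hle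
        gcongr
        exact hbσ.hsNormSq_sub_le x y
    _ = eulerStepConst α β lam Lam h * ‖x - y‖ ^ 2 := by
        rw [eulerStepConst]
        field_simp
        ring

end EulerScheme

section Constants

variable {α β lam Lam h : ℝ}

lemma eulerLSq_eq_add_sq : eulerLSq α β h = 2 * h * (β - α) + (1 - β * h) ^ 2 := by
  unfold eulerLSq
  ring

lemma eulerLSq_nonneg (hh : 0 ≤ h) (hαβ : α ≤ β) : 0 ≤ eulerLSq α β h := by
  have := sub_nonneg.2 hαβ
  rw [eulerLSq_eq_add_sq]
  positivity

lemma eulerStepConst_nonneg (hh : 0 ≤ h) (hlam : 0 ≤ lam) (hLam : 0 ≤ Lam) (hαβ : α ≤ β) :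
    0 ≤ eulerStepConst α β lam Lam h := by
  have := eulerLSq_nonneg hh hαβ
  have := sub_nonneg.2 hαβ
  unfold eulerStepConst
  positivity

lemma eulerStepConst_eq_zero (hh : 0 < h) (hαβ : α ≤ β) (hL : eulerLSq α β h = 0) :
    eulerStepConst α β lam Lam h = 0 := by
  have h_sum := eulerLSq_eq_add_sq ▸ hL
  have h_sub : β - α = 0 := by
    have h_zero := ((add_eq_zero_iff_of_nonneg
      (mul_nonneg (by positivity) (sub_nonneg.2 hαβ)) (sq_nonneg _)).1 h_sum).1
    simpa [hh.ne'] using h_zero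
  simp [eulerStepConst, hL, h_sub]

lemma eulerStepConst_mul_pow_div_geom_sum (hh : 0 < h) (hαβ : α ≤ β) (n : ℕ) :
    eulerStepConst α β lam Lam h * eulerLSq α β h ^ n /
        ∑ i ∈ Finset.range (n + 1), eulerLSq α β h ^ i =
      logHarnackConst α β lam Lam h (n + 1) := by
  rw [logHarnackConst]
  split_ifs with h0 h1
  · rw [eulerStepConst_eq_zero hh hαβ h0, zero_mul, zero_div]
  · simp only [h1, eulerStepConst, one_pow, Finset.sum_const, Finset.card_range, nsmul_eq_mul,
      mul_one, div_div, mul_one_div]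
    congr 1
    ring
  · have h_num : α - β ^ 2 * h / 2 = (1 - eulerLSq α β h) / (2 * h) := by
      rw [eulerLSq]
      field_simp
      ring
    have : eulerLSq α β h - 1 ≠ 0 := sub_ne_zero.2 h1
    have h_pow_sub : eulerLSq α β h ^ (n + 1) - 1 ≠ 0 := sub_ne_zero.2 <|
      (pow_eq_one_iff_of_nonneg (eulerLSq_nonneg hh.le hαβ) n.succ_ne_zero).not.2 h1
    have h_inv_sub : (eulerLSq α β h ^ (n + 1))⁻¹ - 1 =
        -(eulerLSq α β h ^ (n + 1) - 1) / eulerLSq α β h ^ (n + 1) := by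
      field_simp
      ring
    rw [geom_sum_eq h1, h_num, h_inv_sub, eulerStepConst]
    generalize (Lam / lam) ^ 3 = r
    field_simp
    ring

lemma logHarnackConst_le_logHarnackConst' (hh : 0 ≤ h) (hβ : 0 ≤ β) (hlam : 0 ≤ lam)
    (hLam : 0 ≤ Lam) (hαβ : α ≤ β) (hL0 : 0 < eulerLSq α β h) (hL1 : eulerLSq α β h < 1) (N : ℕ) :
    logHarnackConst α β lam Lam h N ≤ logHarnackConst' α β lam Lam h N := by
  rw [logHarnackConst, if_neg hL0.ne', if_neg hL1.ne, logHarnackConst']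
  have h_inv : 0 ≤ (eulerLSq α β h ^ N)⁻¹ - 1 :=
    sub_nonneg.2 ((one_le_inv₀ (by positivity)).2 (pow_le_one₀ hL0.le hL1.le))
  have h_sub := sub_nonneg.2 hαβ
  gcongr
  nlinarith [mul_nonneg (mul_nonneg hβ hh) h_sub]

end Constants

section EulerIteration

variable {d m : ℕ} {α β lam Lam h : ℝ}
  {b : ℝ → EuclideanSpace ℝ (Fin d) → EuclideanSpace ℝ (Fin d)}
  {σ : ℝ → EuclideanSpace ℝ (Fin d) → Matrix (Fin d) (Fin m) ℝ}

lemma eulerKernelIter_eq_kernelIter (n : ℕ) :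
    eulerKernelIter h b σ n = kernelIter (fun i ↦ eulerKernel h (b (i * h)) (σ (i * h))) n := by
  induction n with
  | zero => rfl
  | succ n ih => rw [eulerKernelIter, kernelIter, ih]

lemma isMarkovKernel_eulerKernelIter {N : ℕ} (hh : 0 ≤ h)
    (hbσ : ∀ i < N, DissipativeLipschitz (b (i * h)) (σ (i * h)) α β) :
    IsMarkovKernel (eulerKernelIter h b σ N) := by
  rw [eulerKernelIter_eq_kernelIter]
  exact isMarkovKernel_kernelIter fun i hi ↦
    (sqCouplingContraction_eulerKernel hh (hbσ i hi)).isMarkovKernel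

theorem entropyCostLE_eulerKernelIter {n : ℕ} (hh : 0 < h) (hlam : 0 < lam) (hle : lam ≤ Lam)
    (hαβ : α ≤ β) (hbσ : ∀ i < n + 1, DissipativeLipschitz (b (i * h)) (σ (i * h)) α β)
    (hσ : ∀ i < n + 1, UniformlyElliptic (σ (i * h)) lam Lam) :
    EntropyCostLE (eulerKernelIter h b σ (n + 1)) (logHarnackConst α β lam Lam h (n + 1)) := by
  rw [eulerKernelIter_eq_kernelIter, ← eulerStepConst_mul_pow_div_geom_sum hh hαβ]
  exact EntropyCostLE.kernelIter
    (eulerStepConst_nonneg hh.le hlam.le (hlam.le.trans hle) hαβ) (eulerLSq_nonneg hh.le hαβ) n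
    (fun i hi ↦ entropyCostLE_eulerKernel hh hlam hle (hbσ i hi) (hσ i hi))
    (fun i hi ↦ sqCouplingContraction_eulerKernel hh.le (hbσ i hi))

end EulerIteration

theorem mainTheorem12 {d m : ℕ} (N : ℕ) (hN : 1 ≤ N) (h : ℝ) (hh : 0 < h)
    (b : ℝ → EuclideanSpace ℝ (Fin d) → EuclideanSpace ℝ (Fin d))
    (σ : ℝ → EuclideanSpace ℝ (Fin d) → Matrix (Fin d) (Fin m) ℝ)
    (α β lam Lam : ℝ) (hβ : 0 < β) (hlam : 0 < lam) (hLam : 0 < Lam)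
    (h_contr : ∀ t ∈ Set.Icc (0 : ℝ) (N * h), ∀ x y : EuclideanSpace ℝ (Fin d),
      inner ℝ (b t x - b t y) (x - y) + 1 / 2 * hsNormSq (σ t x - σ t y) ≤ -α * ‖x - y‖ ^ 2)
    (h_ell : ∀ t ∈ Set.Icc (0 : ℝ) (N * h), ∀ x : EuclideanSpace ℝ (Fin d),
      (σ t x * (σ t x).transpose - lam • (1 : Matrix (Fin d) (Fin d) ℝ)).PosSemidef)
    (h_lip : ∀ t ∈ Set.Icc (0 : ℝ) (N * h), ∀ x y : EuclideanSpace ℝ (Fin d),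
      ‖b t x - b t y‖ ≤ β * ‖x - y‖)
    (h_bdd : ∀ t ∈ Set.Icc (0 : ℝ) (N * h), ∀ x : EuclideanSpace ℝ (Fin d),
      (Lam • (1 : Matrix (Fin d) (Fin d) ℝ) - σ t x * (σ t x).transpose).PosSemidef) :
    LogHarnack (eulerKernelIter h b σ N) (logHarnackConst α β lam Lam h N) ∧
      (0 < eulerLSq α β h → eulerLSq α β h < 1 →
        LogHarnack (eulerKernelIter h b σ N) (logHarnackConst' α β lam Lam h N)) := by
  have h_grid (i : ℕ) (hi : i < N) : (i * h : ℝ) ∈ Set.Icc (0 : ℝ) (N * h) :=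
    ⟨by positivity, by gcongr⟩
  have hbσ (i : ℕ) (hi : i < N) : DissipativeLipschitz (b (i * h)) (σ (i * h)) α β :=
    ⟨h_contr _ (h_grid i hi), h_lip _ (h_grid i hi)⟩
  have hσ (i : ℕ) (hi : i < N) : UniformlyElliptic (σ (i * h)) lam Lam :=
    ⟨h_ell _ (h_grid i hi), h_bdd _ (h_grid i hi)⟩
  have := isMarkovKernel_eulerKernelIter hh.le hbσ
  rcases subsingleton_or_nontrivial (EuclideanSpace ℝ (Fin d)) with _ | _
  · exact ⟨.of_subsingleton, fun _ _ ↦ .of_subsingleton⟩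
  have hαβ := (hbσ 0 hN).rate_le_lipschitz
  have h_main : LogHarnack (eulerKernelIter h b σ N) (logHarnackConst α β lam Lam h N) := by
    obtain ⟨n, rfl⟩ := Nat.exists_eq_add_of_le' hN
    exact (entropyCostLE_eulerKernelIter hh hlam (hσ 0 hN).lower_le_upper hαβ hbσ hσ).logHarnack
  exact ⟨h_main, fun hL0 hL1 ↦ h_main.mono
    (logHarnackConst_le_logHarnackConst' hh.le hβ.le hlam.le hLam.le hαβ hL0 hL1 N)⟩
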